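/- **Theorem.** Let $X$ be a countable set and let $R=(R_i)_{i\in I}$ be a family of relations $R_i\subseteq X^{m_i}$, $m_i\in\mathbb N$ (a relational structure, of arbitrary signature $(m_i)_{i\in I}$). Let $\mathrm{Aut}(X,R)\le\mathrm{Sym}(X)$ be the group of those permutations $g$ of $X$ for which $g$ and $g^{-1}$ preserve every $R_i$. Suppose that 1. $(X,R)$ is homogeneous: every isomorphism between finite (induced) substructures of $(X,R)$ extends to an automorphism of $(X,R)$; 2. the age $\mathcal C$ of $(X,R)$, i.e. the class of all finite structures that are isomorphic to a substructure of $(X,R)$, has the free amalgamation property: whenever $(X_1,R_1),(X_2,R_2)\in\mathcal C$ induce the same substructure on $X_1\cap X_2$, the structure on $X_1\cup X_2$ in which each relation is the union of the corresponding relations of $(X_1,R_1)$ and of $(X_2,R_2)$ belongs to $\mathcal C$; 3. $\mathrm{Aut}(X,R)$ acts transitively on $X$; 4. $\mathrm{Aut}(X,R)\neq\mathrm{Sym}(X)$. Then $G=\mathrm{Aut}(X,R)$ has no mixed identities: for every $r\in\mathbb N$ there is no element $w\neq 1$ of the free product $G*\mathbf F_r$, where $\mathbf F_r$ is the free group on $x_1,\dots,x_r$,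 such that $w(g_1,\dots,g_r)=1_G$ for all $g_1,\dots,g_r\in G$. Here $w(g_1,\dots,g_r)\in G$ denotes the image of $w$ under the unique homomorphism $G*\mathbf F_r\to G$ that is the identity on $G$ and maps $x_i$ to $g_i$ for $i=1,\dots,r$. -/

import Mathlib

universe u v w

namespace MixedId

open FirstOrder FirstOrder.Language CategoryTheory

/-- The automorphism group of an `L`-structure `X`, as a subgroup of the symmetric group of `X`:
the permutations of `X` that preserve the structure in both directions. -/
def autGroup (L : FirstOrder.Language.{u, v}) (X : Type w) [L.Structure X] :
    Subgroup (Equiv.Perm X) where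
  carrier := {g | ∃ φ : X ≃[L] X, φ.toEquiv = g}
  one_mem' := ⟨FirstOrder.Language.Equiv.refl L X, rfl⟩
  mul_mem' := by
    rintro _ _ ⟨φ, rfl⟩ ⟨ψ, rfl⟩
    exact ⟨φ.comp ψ, rfl⟩
  inv_mem' := by
    rintro _ ⟨φ, rfl⟩
    exact ⟨φ.symm, rfl⟩

/-- `Q`, with `e₁ : M₁ ↪ Q` and `e₂ : M₂ ↪ Q`, is the free amalgam of `M₁` and `M₂` over their
common substructure `M₀`: its domain is the union of `M₁` and `M₂`, these meet exactly in `M₀`,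
and each relation of `Q` is the union of the corresponding relations of `M₁` and `M₂`. -/
structure IsFreeAmalgam {L : FirstOrder.Language.{u, v}} {M₀ M₁ M₂ Q : Type w}
    [L.Structure M₀] [L.Structure M₁] [L.Structure M₂] [L.Structure Q]
    (f₁ : M₀ ↪[L] M₁) (f₂ : M₀ ↪[L] M₂) (e₁ : M₁ ↪[L] Q) (e₂ : M₂ ↪[L] Q) : Prop where
  comm : ∀ c : M₀, e₁ (f₁ c) = e₂ (f₂ c)
  union : ∀ q : Q, (∃ a : M₁, e₁ a = q) ∨ (∃ b : M₂, e₂ b = q)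
  inter : ∀ (a : M₁) (b : M₂), e₁ a = e₂ b → ∃ c : M₀, f₁ c = a ∧ f₂ c = b
  rel : ∀ {n : ℕ} (R : L.Relations n) (x : Fin n → Q),
    Structure.RelMap R x ↔
      (∃ y : Fin n → M₁, (∀ i, e₁ (y i) = x i) ∧ Structure.RelMap R y) ∨
      (∃ y : Fin n → M₂, (∀ i, e₂ (y i) = x i) ∧ Structure.RelMap R y)

/-- The free amalgamation property of a class `K` of structures: any two members of `K` have their
free amalgam over any common substructure in `K`. (For classes closed under isomorphism it does
not matter which copy of the free amalgam is taken.) -/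
def FreeAmalgamation {L : FirstOrder.Language.{u, v}} (K : Set (Bundled.{w} L.Structure)) : Prop :=
  ∀ (M₀ M₁ M₂ : Bundled.{w} L.Structure) (f₁ : M₀ ↪[L] M₁) (f₂ : M₀ ↪[L] M₂),
    M₀ ∈ K → M₁ ∈ K → M₂ ∈ K →
      ∃ (Q : Bundled.{w} L.Structure) (e₁ : M₁ ↪[L] Q) (e₂ : M₂ ↪[L] Q),
        Q ∈ K ∧ IsFreeAmalgam f₁ f₂ e₁ e₂

/-- Words with constants in the group `G` and in the `r` variables `x₁, …, x_r`: the elements of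
the free product of `G` and the free group of rank `r`. -/
abbrev WordWithConstants (G : Type w) [Group G] (r : ℕ) : Type w :=
  Monoid.Coprod G (FreeGroup (Fin r))

/-- The value `w(g₁, …, g_r)`: the image of `w` under the homomorphism that fixes `G` elementwise
and maps `xᵢ` to `gᵢ`. -/
def wordEval {G : Type w} [Group G] {r : ℕ} (W : WordWithConstants G r) (g : Fin r → G) : G :=
  Monoid.Coprod.lift (MonoidHom.id G) (FreeGroup.lift g) W

/-- `W` is a mixed identity for `G`: it is nontrivial in the free product and `W(Gʳ) = {1}`. -/
def IsMixedIdentity {G : Type w} [Group G] {r : ℕ} (W : WordWithConstants G r) : Prop :=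
  W ≠ 1 ∧ Set.range (wordEval W) = {1}

end MixedId

/-! Write a word as `⋯ c₂ x₂ c₁ x₁ c₀`, each `xₖ` a signed variable, with no trivial constant
between a variable and its inverse. If a variable occurs, follow one point through the word from
right to left: each letter prescribes one more value of a variable, chosen generically so that the
path avoids every point used before and its endpoint differs from its start
(`exists_extend_generic`).

The delicate case is a variable followed by its inverse, where the constant between must move the
current point. So a nontrivial `c` has to move points in every orbit, outside a finite `D`, of the
pointwise stabilizer of `D` (`exists_stabilizer_smul_moved`). Take a related tuple with entries `xᵢ
≠ xⱼ`, with `xᵢ` in that orbit and `xⱼ` moved by `c`, and move `xᵢ` freely over the other entries.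
If `c` then fixed `xᵢ`, the image tuple would relate `xᵢ` to `c • xⱼ`, from which it is free
(`exists_moved_of_relMap`). -/

namespace MixedId

open FirstOrder FirstOrder.Language CategoryTheory

/-! ### Free amalgamation inside a homogeneous structure -/

section FreeHomogeneous

variable {L : FirstOrder.Language.{u, v}} {X : Type w} [L.Structure X]

/-- The substructure of a relational structure carried by a subset. -/
def substructureOfSet (L : FirstOrder.Language.{u, v}) [L.IsRelational] {X : Type w}
    [L.Structure X] (A : Set X) : L.Substructure X where
  carrier := A
  fun_mem f := isEmptyElim f

theorem substructureOfSet_fg [L.IsRelational] {A : Set X} (hA : A.Finite) :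
    (substructureOfSet L A).FG :=
  Substructure.fg_def.2 ⟨A, hA, (substructureOfSet L A).closure_eq⟩

theorem relMap_smul (g : autGroup L X) {n : ℕ} (R : L.Relations n) (x : Fin n → X) :
    Structure.RelMap R (fun i => g • x i) ↔ Structure.RelMap R x := by
  obtain ⟨_, φ, rfl⟩ := g
  exact φ.map_rel' R x

theorem exists_autGroup_extends (hhom : L.IsUltrahomogeneous X) {S : L.Substructure X}
    (hS : S.FG) (f : S ↪[L] X) : ∃ g : autGroup L X, ∀ a : S, g • (a : X) = f a := by
  obtain ⟨φ, hφ⟩ := hhom S hS f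
  refine ⟨⟨φ.toEquiv, φ, rfl⟩, fun a => ?_⟩
  rw [hφ]
  rfl

/-- Finite partial isomorphisms of an ultrahomogeneous relational structure extend to
automorphisms. -/
theorem exists_smul_eq_of_partial_iso [L.IsRelational] (hhom : L.IsUltrahomogeneous X)
    {A : Set X} (hA : A.Finite) (f : X → X) (hinj : Set.InjOn f A)
    (hrel : ∀ {n : ℕ} (R : L.Relations n) (x : Fin n → X), (∀ i, x i ∈ A) →
      (Structure.RelMap R (fun i => f (x i)) ↔ Structure.RelMap R x)) :
    ∃ g : autGroup L X, ∀ a ∈ A, g • a = f a := by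
  let F : substructureOfSet L A ↪[L] X :=
    { toFun := fun a => f a
      inj' := fun a b h => Subtype.ext (hinj a.2 b.2 h)
      map_fun' := fun f => isEmptyElim f
      map_rel' := fun R x => hrel R (fun i => (x i : X)) fun i => (x i).2 }
  obtain ⟨g, hg⟩ := exists_autGroup_extends hhom (substructureOfSet_fg hA) F
  exact ⟨g, fun a ha => hg ⟨a, ha⟩⟩

/-- Free amalgamation inside an ultrahomogeneous structure: over a common subset `C`, the finite
set `A` can be moved to a position free from the finite set `B`. -/
theorem exists_smul_free [L.IsRelational] (hhom : L.IsUltrahomogeneous X)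
    (hfree : FreeAmalgamation (L.age X)) {A B C : Set X} (hA : A.Finite) (hB : B.Finite)
    (hCA : C ⊆ A) (hCB : C ⊆ B) :
    ∃ g : autGroup L X, (∀ c ∈ C, g • c = c) ∧ (∀ a ∈ A, g • a ∈ B → a ∈ C) ∧
      ∀ {n : ℕ} (R : L.Relations n) (x : Fin n → X),
        (∀ i, (∃ a ∈ A, g • a = x i) ∨ x i ∈ B) → Structure.RelMap R x →
        ∀ i j, ∀ a ∈ A, g • a = x i → a ∉ C → x j ∈ B → x j ∈ C := by
  have hage : ∀ {S : Set X}, S.Finite →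
      (⟨substructureOfSet L S, inferInstance⟩ : Bundled.{w} L.Structure) ∈ L.age X := fun hS =>
    ⟨(Substructure.fg_iff_structure_fg _).1 (substructureOfSet_fg hS),
      ⟨(substructureOfSet L _).subtype⟩⟩
  obtain ⟨Q, e₁, e₂, ⟨-, ⟨φ⟩⟩, hQ⟩ := hfree ⟨substructureOfSet L C, inferInstance⟩
    ⟨substructureOfSet L A, inferInstance⟩ ⟨substructureOfSet L B, inferInstance⟩
    (Substructure.inclusion hCA) (Substructure.inclusion hCB)
    (hage (hA.subset hCA)) (hage hA) (hage hB)
  change substructureOfSet L A ↪[L] Q at e₁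
  change substructureOfSet L B ↪[L] Q at e₂
  obtain ⟨h, hh⟩ := exists_autGroup_extends hhom (substructureOfSet_fg hB) (φ.comp e₂)
  obtain ⟨k, hk⟩ := exists_autGroup_extends hhom (substructureOfSet_fg hA) (φ.comp e₁)
  have hk' : ∀ a (ha : a ∈ A), k • a = φ (e₁ ⟨a, ha⟩) := fun a ha => hk ⟨a, ha⟩
  have hh' : ∀ a (ha : a ∈ B), h • a = φ (e₂ ⟨a, ha⟩) := fun a ha => hh ⟨a, ha⟩
  have hC : ∀ c ∈ C, (h⁻¹ * k) • c = c := fun c hc => by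
    rw [mul_smul, inv_smul_eq_iff, hk' c (hCA hc), hh' c (hCB hc)]
    exact congrArg φ (hQ.comm ⟨c, hc⟩)
  have hAB : ∀ a ∈ A, (h⁻¹ * k) • a ∈ B → a ∈ C := fun a ha hb => by
    have h0 : h • (h⁻¹ * k) • a = k • a := by rw [mul_smul, smul_inv_smul]
    have h1 := (hk' a ha).symm.trans (h0.symm.trans (hh' _ hb))
    obtain ⟨c, hc, -⟩ := hQ.inter _ _ (φ.injective h1)
    have : (c : X) = a := congrArg (fun z : substructureOfSet L A => (z : X)) hc
    exact this ▸ c.2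
  refine ⟨h⁻¹ * k, hC, hAB, ?_⟩
  intro n R x hx hR i j a ha hai haC hj
  have hpre : ∀ m, ∃ y : Q, φ y = h • x m := fun m => by
    rcases hx m with ⟨b, hb, hbm⟩ | hb
    · refine ⟨e₁ ⟨b, hb⟩, ?_⟩
      rw [← hbm, mul_smul, smul_inv_smul, hk' b hb]
    · exact ⟨_, (hh' _ hb).symm⟩
  choose y hy using hpre
  have hRy : Structure.RelMap R y := by
    rw [← φ.map_rel]
    have := (relMap_smul h R x).2 hR
    convert this using 1
    exact funext hy
  -- A relation of the free amalgam lies wholly in the copy of `A`, which puts `x j` over `C`, or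
  -- wholly in that of `B`, which forces `a ∈ C`.
  rcases (hQ.rel R y).1 hRy with ⟨z, hz, -⟩ | ⟨z, hz, -⟩
  · have h1 : k • (z j : X) = h • x j := by rw [hk' _ (z j).2, ← hy, ← hz]
    have h2 : (h⁻¹ * k) • (z j : X) = x j := by rw [mul_smul, h1, inv_smul_smul]
    have h3 := hAB _ (z j).2 (h2 ▸ hj)
    rw [← h2, hC _ h3]
    exact h3
  · have h1 : h • (z i : X) = h • x i := by rw [hh' _ (z i).2, ← hy, ← hz]
    have h2 : (z i : X) = x i := smul_left_cancel h h1
    exact absurd (hAB a ha (by rw [hai, ← h2]; exact (z i).2)) haC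

/-- The point `b` lies outside `D`, and no relation involves both `b` and points of `D`. -/
def IsFreeOver (L : FirstOrder.Language.{u, v}) {X : Type w} [L.Structure X] (b : X)
    (D : Set X) : Prop :=
  b ∉ D ∧ ∀ {n : ℕ} (R : L.Relations n) (x : Fin n → X), (∀ i, x i = b ∨ x i ∈ D) →
    Structure.RelMap R x → ∀ i j, x i = b → x j ∉ D

theorem IsFreeOver.mono {b : X} {D E : Set X} (h : IsFreeOver L b E) (hDE : D ⊆ E) :
    IsFreeOver L b D :=
  ⟨fun hb => h.1 (hDE hb), fun R x hx hR i j hi hj =>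
    h.2 R x (fun k => (hx k).imp_right fun hk => hDE hk) hR i j hi (hDE hj)⟩

/-- A related tuple from `D` and `b` either avoids `b` or is constantly `b`. Transitivity carries
the constant tuples to `b'`, so fixing `D` and sending `b` to `b'` is a partial isomorphism. -/
theorem exists_smul_eq_of_isFreeOver [L.IsRelational] (hhom : L.IsUltrahomogeneous X)
    [MulAction.IsPretransitive (autGroup L X) X] {D : Set X} (hD : D.Finite) {b b' : X}
    (hb : IsFreeOver L b D) (hb' : IsFreeOver L b' D) :
    ∃ g : autGroup L X, (∀ d ∈ D, g • d = d) ∧ g • b = b' := by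
  classical
  have key : ∀ {b b' : X}, IsFreeOver L b D → IsFreeOver L b' D → ∀ {n : ℕ} (R : L.Relations n)
      (x y : Fin n → X), (∀ i, (x i = b ∧ y i = b') ∨ (x i ∈ D ∧ y i = x i)) →
      Structure.RelMap R x → Structure.RelMap R y := by
    intro b b' hb hb' n R x y hxy hR
    by_cases h : ∃ i, x i = b
    · obtain ⟨i, hi⟩ := h
      obtain ⟨g, hg⟩ := MulAction.exists_smul_eq (autGroup L X) b b'
      have : y = fun k => g • x k := funext fun k => by
        rcases hxy k with ⟨h1, h2⟩ | ⟨h1, -⟩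
        · rw [h1, h2, hg]
        · exact absurd h1
            (hb.2 R x (fun k => (hxy k).imp And.left And.left) hR i k hi)
      rw [this]
      exact (relMap_smul g R x).2 hR
    · have : y = x := funext fun k => by
        rcases hxy k with ⟨h1, -⟩ | ⟨-, h2⟩
        · exact absurd ⟨k, h1⟩ h
        · exact h2
      rwa [this]
  have hfD : ∀ d ∈ D, (if d = b then b' else d) = d := fun d hd =>
    if_neg fun h : d = b => hb.1 (h ▸ hd)
  obtain ⟨g, hg⟩ := exists_smul_eq_of_partial_iso hhom (hD.insert b)
    (fun a => if a = b then b' else a) (by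
      rintro x (rfl | hx) y (rfl | hy) h
      · rfl
      · simp only [if_true, hfD y hy] at h
        exact absurd (h ▸ hy) hb'.1
      · simp only [if_true, hfD x hx] at h
        exact absurd (h ▸ hx) hb'.1
      · simpa only [hfD x hx, hfD y hy] using h) (by
      intro n R x hx
      have hx' : ∀ i, (x i = b ∧ (if x i = b then b' else x i) = b') ∨
          (x i ∈ D ∧ (if x i = b then b' else x i) = x i) := fun i =>
        (hx i).imp (fun h => ⟨h, if_pos h⟩) fun h => ⟨h, hfD _ h⟩
      exact ⟨key hb' hb R _ _ fun i => (hx' i).imp And.symm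
        fun ⟨h1, h2⟩ => ⟨by rwa [h2], h2.symm⟩, key hb hb' R _ _ hx'⟩)
  exact ⟨g, fun d hd => (hg d (Set.mem_insert_of_mem _ hd)).trans (hfD d hd),
    (hg b (Set.mem_insert _ _)).trans (if_pos rfl)⟩

/-- If only constant tuples were related, all permutations would be automorphisms. -/
theorem exists_relMap_nonconstant [MulAction.IsPretransitive (autGroup L X) X] [L.IsRelational]
    (hne : autGroup L X ≠ ⊤) :
    ∃ (n : ℕ) (R : L.Relations n) (x : Fin n → X) (i j : Fin n),
      Structure.RelMap R x ∧ x i ≠ x j := by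
  by_contra! H
  apply hne
  have key : ∀ (g : Equiv.Perm X) {n : ℕ} (R : L.Relations n) (x : Fin n → X),
      Structure.RelMap R x → Structure.RelMap R (fun i => g (x i)) := by
    intro g n R x hR
    rcases n with _ | n
    · rwa [Subsingleton.elim (fun i => g (x i)) x]
    · obtain ⟨k, hk⟩ := MulAction.exists_smul_eq (autGroup L X) (x 0) (g (x 0))
      have : (fun i => g (x i)) = fun i => k • x i := funext fun i => by
        rw [H _ R x i 0 hR, hk]
      rw [this]
      exact (relMap_smul k R x).2 hR
  refine (Subgroup.eq_top_iff' _).2 fun g => ⟨⟨g, fun f => isEmptyElim f, fun R x => ⟨fun h => ?_,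
    key g R x⟩⟩, rfl⟩
  have := key g⁻¹ R _ h
  convert this using 1
  funext i
  exact (g.symm_apply_apply (x i)).symm

end FreeHomogeneous

/-! ### Points moved by a nontrivial automorphism -/

section Moving

variable {L : FirstOrder.Language.{u, v}} {X : Type w} [L.Structure X]

/-- `x i` is moved freely over `C`, the other entries together with `E`. If `c` fixed the new point,
applying `c` to the tuple would relate that point to `c • x j`, which lies in `B` but not in `C`. -/
theorem exists_moved_of_relMap [L.IsRelational] (hhom : L.IsUltrahomogeneous X)
    (hfree : FreeAmalgamation (L.age X)) (c : autGroup L X) {n : ℕ} (R : L.Relations n)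
    (x : Fin n → X) (i j : Fin n) (hR : Structure.RelMap R x) (hij : x i ≠ x j)
    (hc : ∀ k, x k ≠ c • x j) {E D : Set X} (hE : E.Finite) (hD : D.Finite)
    (hcE : c • x j ∉ E) (hiE : x i ∉ E) :
    ∃ g : autGroup L X, (∀ e ∈ E, g • e = e) ∧ g • x i ∉ D ∧ c • g • x i ≠ g • x i ∧
      ((∀ d ∈ D, d ∉ E ∧ ∀ k, x k ≠ d) → IsFreeOver L (g • x i) D) := by
  have hr : (Set.range x).Finite := Set.finite_range x
  set T : Set X := {t | t ∈ Set.range x ∧ t ≠ x i}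
  have hTf : T.Finite := hr.subset fun t ht => ht.1
  set C : Set X := T ∪ E
  set B : Set X := C ∪ D ∪ (fun t => c • t) '' T
  have hCf : C.Finite := hTf.union hE
  have hCB : C ⊆ B := fun t ht => Or.inl (Or.inl ht)
  have hiC : x i ∉ C := by
    rintro (h | h)
    · exact h.2 rfl
    · exact hiE h
  have hjC : c • x j ∉ C := by
    rintro (⟨⟨k, hk⟩, -⟩ | h)
    · exact hc k hk
    · exact hcE h
  obtain ⟨g, hg, hgB, hgR⟩ := exists_smul_free hhom hfree (A := Set.range x ∪ E) (B := B) (C := C)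
    (hr.union hE) ((hCf.union hD).union (hTf.image _))
    (Set.union_subset_union_left _ fun t ht => ht.1) hCB
  have hiA : x i ∈ Set.range x ∪ E := Or.inl ⟨i, rfl⟩
  refine ⟨g, fun e he => hg e (Or.inr he), fun h => hiC (hgB _ hiA (Or.inl (Or.inr h))), ?_, ?_⟩
  · intro hfix
    have hRy : Structure.RelMap R (fun k => c • g • x k) := by
      rw [relMap_smul c, relMap_smul g]
      exact hR
    have hT' : ∀ k, x k ≠ x i → g • x k = x k ∧ c • x k ∈ B := fun k hk =>
      ⟨hg _ (Or.inl ⟨⟨k, rfl⟩, hk⟩), Or.inr ⟨x k, ⟨⟨k, rfl⟩, hk⟩, rfl⟩⟩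
    have hj := hT' j hij.symm
    have := hgR R _ (fun k => by
      by_cases hk : x k = x i
      · exact Or.inl ⟨x i, hiA, by rw [hk, hfix]⟩
      · refine Or.inr ?_
        rw [(hT' k hk).1]
        exact (hT' k hk).2) hRy i j (x i) hiA hfix.symm hiC (by rw [hj.1]; exact hj.2)
    rw [hj.1] at this
    exact hjC this
  · intro hdis
    refine ⟨fun h => hiC (hgB _ hiA (Or.inl (Or.inr h))), fun S y hy hS p q hp hq => ?_⟩
    have := hgR S y (fun k => (hy k).imp (fun h => ⟨x i, hiA, h.symm⟩)
      fun h => Or.inl (Or.inr h)) hS p q (x i) hiA hp.symm hiC (Or.inl (Or.inr hq))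
    rcases this with ⟨⟨k, hk⟩, -⟩ | h
    · exact (hdis _ hq).2 k hk
    · exact (hdis _ hq).1 h

/-- A nontrivial automorphism has infinite support, and if it moves a point outside the finite set
`D` then it moves a point that is free over `D`. -/
theorem exists_moved_notMem [L.IsRelational] (hhom : L.IsUltrahomogeneous X)
    (hfree : FreeAmalgamation (L.age X)) [MulAction.IsPretransitive (autGroup L X) X]
    (hne : autGroup L X ≠ ⊤) (c : autGroup L X) {b : X} (hb : c • b ≠ b) {D : Set X}
    (hD : D.Finite) :
    ∃ a, a ∉ D ∧ c • a ≠ a ∧ (b ∉ D → IsFreeOver L a D) := by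
  obtain ⟨n, R, x₀, i, j, hR, hij⟩ := exists_relMap_nonconstant hne
  obtain ⟨h, hh⟩ := MulAction.exists_smul_eq (autGroup L X) (x₀ j) b
  -- The tuple passes through `b` at place `j`, and its other entries are pushed off `D` and off `c
  -- • b`.
  obtain ⟨g, hg, hgB, -⟩ := exists_smul_free hhom hfree (A := Set.range fun k => h • x₀ k)
    (B := insert b (insert (c • b) D)) (C := {b}) (Set.finite_range _)
    ((hD.insert _).insert _) (by rintro _ rfl; exact ⟨j, hh⟩) (by rintro _ rfl; exact Or.inl rfl)
  have hgb : g • b = b := hg b rfl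
  have hgB' : ∀ k, g • h • x₀ k ∈ insert b (insert (c • b) D) → g • h • x₀ k = b := fun k hk => by
    have : h • x₀ k = b := hgB _ ⟨k, rfl⟩ hk
    rw [this, hgb]
  have hxj : g • h • x₀ j = b := by rw [hh, hgb]
  obtain ⟨k, -, hk1, hk2, hk3⟩ := exists_moved_of_relMap hhom hfree c R (fun k => g • h • x₀ k) i j
    (by rw [relMap_smul g, relMap_smul h]; exact hR)
    (fun e => hij (smul_left_cancel h (smul_left_cancel g e)))
    (fun k e => by
      simp only [hxj] at e
      exact hb (e.symm.trans (hgB' k (by rw [e]; exact Or.inr (Or.inl rfl)))))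
    Set.finite_empty hD (Set.notMem_empty _) (Set.notMem_empty _)
  refine ⟨_, hk1, hk2, fun hbD => hk3 fun d hd => ⟨Set.notMem_empty _, fun k e => ?_⟩⟩
  have := hgB' k (by simp only [e]; exact Or.inr (Or.inr hd))
  exact hbD (this ▸ e ▸ hd)

/-- If `c` moves a point that is free over `D` to a new point outside `D`, then `c` moves some point
of each orbit of the pointwise stabilizer of `D` outside `D`. -/
theorem exists_stabilizer_smul_moved_of_isFreeOver [L.IsRelational]
    (hhom : L.IsUltrahomogeneous X) (hfree : FreeAmalgamation (L.age X))
    [MulAction.IsPretransitive (autGroup L X) X] (hne : autGroup L X ≠ ⊤) (c : autGroup L X)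
    {D : Set X} (hD : D.Finite) {q : X} (hq : q ∉ D) {b : X} (hb : IsFreeOver L b D)
    (hcb : c • b ≠ b) (hcD : c • b ∉ D) :
    ∃ u : autGroup L X, (∀ d ∈ D, u • d = d) ∧ c • u • q ≠ u • q := by
  obtain ⟨n, R, x₀, i, j, hR, hij⟩ := exists_relMap_nonconstant hne
  obtain ⟨h, hh⟩ := MulAction.exists_smul_eq (autGroup L X) (x₀ i) q
  obtain ⟨g, hg, hgB, hgR⟩ := exists_smul_free hhom hfree (A := Set.range fun k => h • x₀ k)
    (B := insert q D) (C := {q}) (Set.finite_range _)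
    (hD.insert _) (by rintro _ rfl; exact ⟨i, hh⟩) (by rintro _ rfl; exact Or.inl rfl)
  have hgq : g • q = q := hg q rfl
  have hjq : h • x₀ j ≠ q := fun e => hij (smul_left_cancel h (hh.trans e.symm))
  have hfreej : IsFreeOver L (g • h • x₀ j) D := by
    refine ⟨fun hj => hjq (hgB _ ⟨j, rfl⟩ (Or.inr hj)), fun S y hy hS p r hp hr => ?_⟩
    have : y r = q := hgR S y (fun k => (hy k).imp (fun e => ⟨_, ⟨j, rfl⟩, e.symm⟩) Or.inr) hS p r
      _ ⟨j, rfl⟩ hp.symm hjq (Or.inr hr)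
    exact hq (this ▸ hr)
  -- The tuple meets `D ∪ {q}` freely over `q`, so its `j`-th entry is free over `D` and can be
  -- brought to `b` without moving `D`. Then `v` clears `c • b` of entries.
  obtain ⟨u, hu, hub⟩ := exists_smul_eq_of_isFreeOver hhom hD hfreej hb
  obtain ⟨v, hv, hvB, -⟩ := exists_smul_free hhom hfree
    (A := insert b D ∪ Set.range fun k => u • g • h • x₀ k)
    (B := insert (c • b) (insert b D)) (C := insert b D)
    ((hD.insert _).union (Set.finite_range _)) ((hD.insert _).insert _)
    Set.subset_union_left (Set.subset_insert _ _)
  have hvb : v • b = b := hv b (Or.inl rfl)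
  have hxi : v • u • g • h • x₀ i = v • u • q := by rw [hh, hgq]
  have hxj : v • u • g • h • x₀ j = b := by rw [hub, hvb]
  have hvu : ∀ d ∈ D, (v * u) • d = d := fun d hd => by rw [mul_smul, hu d hd, hv d (Or.inr hd)]
  obtain ⟨k, hk, -, hk2, -⟩ := exists_moved_of_relMap hhom hfree c R
    (fun k => v • u • g • h • x₀ k) i j
    (by rw [relMap_smul v, relMap_smul u, relMap_smul g, relMap_smul h]; exact hR)
    (fun e => hij (smul_left_cancel h (smul_left_cancel g (smul_left_cancel u
      (smul_left_cancel v e)))))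
    (fun k e => by
      simp only [hxj] at e
      have hk := hvB _ (Or.inr ⟨k, rfl⟩) (by simp only [e]; exact Or.inl rfl)
      have hk' := hv _ hk
      simp only [e] at hk'
      rcases hk with hk | hk
      · exact hcb (hk'.trans hk)
      · exact hcD (by rw [hk']; exact hk))
    hD Set.finite_empty (by simp only [hxj]; exact hcD) (by
      simp only [hxi]
      intro hmem
      rw [← mul_smul] at hmem
      have hfix := smul_left_cancel _ (hvu _ hmem)
      exact hq (hfix ▸ hmem))
  refine ⟨k * (v * u), fun d hd => by rw [mul_smul, hvu d hd, hk d hd], ?_⟩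
  simpa only [hxi, mul_smul] using hk2

theorem exists_stabilizer_smul_notMem [L.IsRelational] (hhom : L.IsUltrahomogeneous X)
    (hfree : FreeAmalgamation (L.age X)) {D F : Set X} (hD : D.Finite) (hF : F.Finite) {q : X}
    (hq : q ∉ D) : ∃ u : autGroup L X, (∀ d ∈ D, u • d = d) ∧ u • q ∉ D ∪ F := by
  obtain ⟨u, hu, huB, -⟩ := exists_smul_free hhom hfree (A := insert q D) (B := D ∪ F) (C := D)
    (hD.insert q) (hD.union hF) (Set.subset_insert _ _) Set.subset_union_left
  exact ⟨u, hu, fun h => hq (huB q (Or.inl rfl) h)⟩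

/-- Every nontrivial automorphism moves infinitely many points of each orbit, outside the finite set
`D`, of the pointwise stabilizer of `D`. -/
theorem exists_stabilizer_smul_moved [L.IsRelational] (hhom : L.IsUltrahomogeneous X)
    (hfree : FreeAmalgamation (L.age X)) [MulAction.IsPretransitive (autGroup L X) X]
    (hne : autGroup L X ≠ ⊤) (c : autGroup L X) {D F : Set X} (hD : D.Finite) (hF : F.Finite)
    {q : X} (hq : q ∉ D) :
    ∃ u : autGroup L X, (∀ d ∈ D, u • d = d) ∧ u • q ∉ F ∧ (c ≠ 1 → c • u • q ≠ u • q) := by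
  obtain ⟨u, hu, huF⟩ := exists_stabilizer_smul_notMem hhom hfree hD hF hq
  by_cases hc : c = 1
  · exact ⟨u, hu, fun h => huF (Or.inr h), fun h => absurd hc h⟩
  obtain ⟨b₀, hb₀⟩ : ∃ b : X, c • b ≠ b := by
    by_contra! h
    exact hc (eq_of_smul_eq_smul (α := X) fun b => by rw [h b, one_smul])
  set D' : Set X := D ∪ F
  have hfin : D'.Finite := hD.union hF
  have hfin' : (D' ∪ (fun d => c⁻¹ • d) '' D').Finite := hfin.union (hfin.image _)
  -- The first use finds a moved point outside the finite set, which the second turns into a free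
  -- one. Including `c⁻¹ • D'` ensures `c • b ∉ D'`.
  obtain ⟨a, ha, hca, -⟩ := exists_moved_notMem hhom hfree hne c hb₀ hfin'
  obtain ⟨b, -, hcb, hb⟩ := exists_moved_notMem hhom hfree hne c hca hfin'
  obtain ⟨k, hk, hkq⟩ := exists_stabilizer_smul_moved_of_isFreeOver hhom hfree hne c hfin huF
    ((hb ha).mono Set.subset_union_left) hcb
    fun h => (hb ha).1 (Or.inr ⟨_, h, inv_smul_smul c b⟩)
  refine ⟨k * u, fun d hd => by rw [mul_smul, hu d hd, hk d (Or.inl hd)], fun h => ?_, fun _ => ?_⟩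
  · rw [mul_smul] at h
    have h1 := smul_left_cancel k (hk _ (Or.inr h))
    exact huF (Or.inr (h1 ▸ h))
  · rwa [mul_smul]

end Moving

/-! ### Reduced spellings of words with constants -/

section Words

variable {G : Type w} [Group G] {r : ℕ}

theorem wordEval_mul (V W : WordWithConstants G r) (g : Fin r → G) :
    wordEval (V * W) g = wordEval V g * wordEval W g :=
  map_mul (Monoid.Coprod.lift (MonoidHom.id G) (FreeGroup.lift g)) V W

theorem wordEval_inl (c : G) (g : Fin r → G) :
    wordEval (Monoid.Coprod.inl c : WordWithConstants G r) g = c :=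
  Monoid.Coprod.lift_apply_inl _ _ c

/-- The variable `xᵢ` or its inverse, as a word. -/
def signedVariable (G : Type w) [Group G] {r : ℕ} (i : Fin r) (e : Bool) :
    WordWithConstants G r :=
  Monoid.Coprod.inr (cond e (FreeGroup.of i) (FreeGroup.of i)⁻¹)

theorem wordEval_signedVariable (i : Fin r) (e : Bool) (g : Fin r → G) :
    wordEval (signedVariable G i e) g = cond e (g i) (g i)⁻¹ := by
  refine (Monoid.Coprod.lift_apply_inr _ _ _).trans ?_
  cases e <;> simp

theorem signedVariable_mul_not (i : Fin r) (e : Bool) :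
    signedVariable G i e * signedVariable G i (!e) = 1 := by
  cases e <;> simp [signedVariable]

/-- The word `⋯ c₂ x₂ c₁ x₁` spelled by the list of triples (index and sign of the variable `xₖ`,
constant `cₖ`), read from right to left. -/
def spell : List (Fin r × Bool × G) → WordWithConstants G r
  | [] => 1
  | l :: ℓ => spell ℓ * (Monoid.Coprod.inl l.2.2 * signedVariable G l.1 l.2.1)

/-- No trivial constant separates a variable from its inverse. -/
def IsReducedSpelling (ℓ : List (Fin r × Bool × G)) : Prop :=
  ℓ.IsChain fun a b => a.1 = b.1 → a.2.1 = !b.2.1 → a.2.2 ≠ 1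

/-- Reduced forms are stable under right multiplication by constants and signed variables: a
variable cancels the head of the list or is prepended to it. Uniqueness is not needed. -/
theorem exists_reduced_spelling (W : WordWithConstants G r) :
    ∃ (ℓ : List (Fin r × Bool × G)) (c : G), IsReducedSpelling ℓ ∧
      W = spell ℓ * Monoid.Coprod.inl c := by
  let P : WordWithConstants G r → Prop := fun W =>
    ∃ (ℓ : List (Fin r × Bool × G)) (c : G), IsReducedSpelling ℓ ∧
      W = spell ℓ * Monoid.Coprod.inl c
  have hvar : ∀ (i : Fin r) (e : Bool) (V), P V → P (V * signedVariable G i e) := by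
    rintro i e _ ⟨ℓ, c, hℓ, rfl⟩
    by_cases hcancel : c = 1 ∧ ∃ c' ℓ', ℓ = (i, !e, c') :: ℓ'
    · obtain ⟨rfl, c', ℓ', rfl⟩ := hcancel
      refine ⟨ℓ', c', hℓ.tail, ?_⟩
      have := signedVariable_mul_not (G := G) i (!e)
      rw [Bool.not_not] at this
      simp only [spell, map_one, mul_one, mul_assoc, this]
    · refine ⟨(i, e, c) :: ℓ, 1, ?_, by simp only [spell, map_one, mul_one, mul_assoc]⟩
      refine List.isChain_cons.2 ⟨?_, hℓ⟩
      rintro ⟨i', e', c'⟩ hy hi he hc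
      obtain ⟨ℓ', rfl⟩ : ∃ ℓ', ℓ = (i', e', c') :: ℓ' := by
        cases ℓ with
        | nil => simp at hy
        | cons a t => exact ⟨t, by simpa using hy⟩
      simp only at hi he hc
      subst hi he hc
      exact hcancel ⟨rfl, c', ℓ', by rw [Bool.not_not]⟩
  have hmul : ∀ W V, P V → P (V * W) := fun W => by
    induction W using Monoid.Coprod.induction_on with
    | inl d =>
      rintro _ ⟨ℓ, c, hℓ, rfl⟩
      exact ⟨ℓ, c * d, hℓ, by rw [map_mul, mul_assoc]⟩
    | inr x =>
      induction x using FreeGroup.induction_on with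
      | C1 => simp
      | of i => exact fun V => hvar i true V
      | inv_of i _ => exact fun V => hvar i false V
      | mul x y hx hy =>
        intro V hV
        rw [map_mul, ← mul_assoc]
        exact hy _ (hx _ hV)
    | mul x y hx hy =>
      intro V hV
      rw [← mul_assoc]
      exact hy _ (hx _ hV)
  have := hmul W 1 ⟨[], 1, List.isChain_nil, by simp [spell]⟩
  rwa [one_mul] at this

end Words

/-! ### Building a substitution letter by letter -/

section Main

variable {L : FirstOrder.Language.{u, v}} {X : Type w} [L.Structure X]

/-- One step of the approximation of a substitution: an automorphism `g`, prescribed on the finite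
set `D`, is modified outside `D` so that the value of `c x^{±1}` at `q` is generic. -/
theorem exists_extend_generic [L.IsRelational] (hhom : L.IsUltrahomogeneous X)
    (hfree : FreeAmalgamation (L.age X)) [MulAction.IsPretransitive (autGroup L X) X]
    (hne : autGroup L X ≠ ⊤) (g c : autGroup L X) (e : Bool) {D F : Set X} (hD : D.Finite)
    (hF : F.Finite) (q : X) (hq : cond e q (g⁻¹ • q) ∉ D) :
    ∃ (g' : autGroup L X) (D' : Set X) (p : X), D'.Finite ∧ D ⊆ D' ∧ (∀ d ∈ D, g' • d = g • d) ∧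
      (∀ k : autGroup L X, (∀ d ∈ D', k • d = g' • d) → (cond e k k⁻¹) • q = p) ∧ c • p ∉ F ∧
      ∀ e', (e = !e' → c ≠ 1) → cond e' (c • p) (g'⁻¹ • c • p) ∉ D' := by
  set Z : Set X := F ∪ D ∪ (fun d => g • d) '' D ∪ {q}
  have hZf : Z.Finite := ((hF.union hD).union (hD.image _)).union (Set.finite_singleton q)
  have hZF : ∀ z, z ∉ Z → z ∉ F := fun z h h' => h (Or.inl (Or.inl (Or.inl h')))
  have hZD : ∀ z, z ∉ Z → z ∉ D := fun z h h' => h (Or.inl (Or.inl (Or.inr h')))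
  have hZg : ∀ z, z ∉ Z → ∀ d ∈ D, z ≠ g • d := fun z h d hd h' =>
    h (Or.inl (Or.inr ⟨d, hd, h'.symm⟩))
  have hZq : ∀ z, z ∉ Z → z ≠ q := fun z h h' => h (Or.inr h')
  cases e with
  | true =>
    rw [cond_true] at hq
    -- Precomposing `g` with the stabilizer of `D` keeps its values there. The conjugate `g⁻¹ * c *
    -- g` moves `u • q` exactly when `c` moves `g • u • q`.
    obtain ⟨u, hu, huF, huc⟩ := exists_stabilizer_smul_moved hhom hfree hne (g⁻¹ * c * g)
      hD (hZf.image fun z => (c * g)⁻¹ • z) hq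
    have hp : c • g • u • q ∉ Z := fun h => huF ⟨_, h, by simp only [← mul_smul]; group⟩
    have hagree : ∀ d ∈ D, (g * u) • d = g • d := fun d hd => by rw [mul_smul, hu d hd]
    have hmoved : c ≠ 1 → c • g • u • q ≠ g • u • q := fun hc h => huc
      (fun h' => hc (by
        calc c = g * (g⁻¹ * c * g) * g⁻¹ := by group
          _ = 1 := by rw [h']; group))
      (by rw [mul_smul, mul_smul, h, inv_smul_smul])
    refine ⟨g * u, insert q D, g • u • q, hD.insert q, Set.subset_insert _ _, hagree,
      fun k hk => by rw [← mul_smul]; exact hk q (Or.inl rfl), hZF _ hp, fun e' he' => ?_⟩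
    cases e' with
    | true =>
      rintro (h | h)
      · exact hZq _ hp h
      · exact hZD _ hp h
    | false =>
      rintro (h | h)
      · exact hmoved (he' rfl) (by rw [← mul_smul g u, ← inv_smul_eq_iff, mul_smul]; exact h)
      · refine hZg _ hp _ h ?_
        rw [← hagree _ h]
        exact (smul_inv_smul _ _).symm
  | false =>
    have hq' : q ∉ (fun d => g • d) '' D := by
      rintro ⟨d, hd, rfl⟩
      exact hq (by simpa using hd)
    obtain ⟨u, hu, huF, huc⟩ := exists_stabilizer_smul_moved hhom hfree hne (g * c * g⁻¹)
      (hD.image fun d => g • d) (hZf.image fun z => (c * g⁻¹)⁻¹ • z) hq'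
    have hp : c • g⁻¹ • u • q ∉ Z := fun h => huF ⟨_, h, by simp only [← mul_smul]; group⟩
    have hagree : ∀ d ∈ D, (u⁻¹ * g) • d = g • d := fun d hd => by
      rw [mul_smul, inv_smul_eq_iff, hu _ ⟨d, hd, rfl⟩]
    have hgp : (u⁻¹ * g) • g⁻¹ • u • q = q := by simp only [← mul_smul]; simp
    have hmoved : c ≠ 1 → c • g⁻¹ • u • q ≠ g⁻¹ • u • q := fun hc h => huc
      (fun h' => hc (by
        calc c = g⁻¹ * (g * c * g⁻¹) * g := by group
          _ = 1 := by rw [h']; group))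
      (by rw [mul_smul, mul_smul, h, smul_inv_smul])
    refine ⟨u⁻¹ * g, insert (g⁻¹ • u • q) D, g⁻¹ • u • q, hD.insert _, Set.subset_insert _ _, hagree,
      fun k hk => inv_smul_eq_iff.2 ?_, hZF _ hp, fun e' he' => ?_⟩
    · rw [hk _ (Or.inl rfl), hgp]
    · cases e' with
      | true =>
        rintro (h | h)
        · exact hmoved (he' rfl) h
        · exact hZD _ hp h
      | false =>
        rintro (h | h)
        · exact hZq _ hp ((inv_smul_eq_iff.1 h).trans hgp)
        · refine hZg _ hp _ h ?_
          rw [← hagree _ h]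
          exact (smul_inv_smul _ _).symm

/-- `D i` is the finite set on which the `i`-th variable is already committed; `hq` says that the
next letter applied to `q` is still uncommitted. -/
theorem exists_wordEval_spell_notMem [L.IsRelational] (hhom : L.IsUltrahomogeneous X)
    (hfree : FreeAmalgamation (L.age X)) [MulAction.IsPretransitive (autGroup L X) X]
    (hne : autGroup L X ≠ ⊤) {r : ℕ} (ℓ : List (Fin r × Bool × autGroup L X))
    (hℓ : IsReducedSpelling ℓ) {F : Set X} (hF : F.Finite) (g : Fin r → autGroup L X)
    (D : Fin r → Set X) (hD : ∀ i, (D i).Finite) (q : X)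
    (hq : ∀ l ∈ ℓ.head?, cond l.2.1 q ((g l.1)⁻¹ • q) ∉ D l.1) (hqF : ℓ = [] → q ∉ F) :
    ∃ g' : Fin r → autGroup L X, (∀ i, ∀ d ∈ D i, g' i • d = g i • d) ∧
      wordEval (spell ℓ) g' • q ∉ F := by
  induction ℓ generalizing g D q with
  | nil =>
    exact ⟨g, fun _ _ _ => rfl, by
      rw [spell, wordEval, map_one, one_smul]
      exact hqF rfl⟩
  | cons l ℓ ih =>
    obtain ⟨i, e, c⟩ := l
    -- The next letter may be another variable with either sign, so all committed arguments and
    -- values are avoided.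
    have hfin : (F ∪ ⋃ j, (D j ∪ (fun d => g j • d) '' D j)).Finite :=
      hF.union (Set.finite_iUnion fun j => (hD j).union ((hD j).image _))
    obtain ⟨k, E, p, hE, hDE, hk, hp, hcp, hnext⟩ := exists_extend_generic hhom hfree hne (g i) c e
      (hD i) hfin q (hq _ rfl)
    obtain ⟨hhead, htail⟩ := List.isChain_cons.1 hℓ
    obtain ⟨g', hg', hF'⟩ := ih htail (Function.update g i k) (Function.update D i E)
      (fun j => by
        rcases eq_or_ne j i with rfl | hj
        · rwa [Function.update_self]
        · rw [Function.update_of_ne hj]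
          exact hD j) (c • p) (by
        rintro ⟨j, e', c'⟩ hl
        rcases eq_or_ne j i with rfl | hj
        · simp only [Function.update_self]
          exact hnext e' (hhead _ hl rfl)
        · simp only [Function.update_of_ne hj]
          have hj' : ∀ z, z ∈ D j ∪ (fun d => g j • d) '' D j → c • p ≠ z := fun z hz h =>
            hcp (Or.inr (Set.mem_iUnion.2 ⟨j, h ▸ hz⟩))
          cases e' with
          | true => exact fun h => hj' _ (Or.inl h) rfl
          | false => exact fun h => hj' _ (Or.inr ⟨_, h, rfl⟩) (smul_inv_smul _ _).symm)
      (fun _ h => hcp (Or.inl h))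
    have hg'E : ∀ d ∈ E, g' i • d = k • d := fun d hd => by
      simpa using hg' i d (by rwa [Function.update_self])
    refine ⟨g', fun j d hd => ?_, ?_⟩
    · rcases eq_or_ne j i with rfl | hj
      · rw [hg'E d (hDE hd), hk d hd]
      · simpa [hj] using hg' j d (by rwa [Function.update_of_ne hj])
    · rw [spell, wordEval_mul, wordEval_mul, wordEval_inl, wordEval_signedVariable, mul_smul,
        mul_smul, hp _ hg'E]
      exact hF'

end Main

end MixedId

theorem mainTheorem7 (L : FirstOrder.Language.{u, v}) [L.IsRelational]
    (X : Type w) [Countable X] [L.Structure X]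
    (hhom : L.IsUltrahomogeneous X)
    (hfree : MixedId.FreeAmalgamation (L.age X))
    (htrans : MulAction.IsPretransitive (MixedId.autGroup L X) X)
    (hne : MixedId.autGroup L X ≠ ⊤) :
    ∀ (r : ℕ) (W : MixedId.WordWithConstants (MixedId.autGroup L X) r),
      ¬ MixedId.IsMixedIdentity W := by
  rintro r W ⟨hW, hrange⟩
  have heval : ∀ g, MixedId.wordEval W g = 1 := fun g => by
    have : MixedId.wordEval W g ∈ Set.range (MixedId.wordEval W) := ⟨g, rfl⟩
    rwa [hrange] at this
  obtain ⟨ℓ, c, hℓ, rfl⟩ := MixedId.exists_reduced_spelling W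
  rcases eq_or_ne ℓ [] with rfl | hne'
  · have hc := heval fun _ => 1
    rw [MixedId.wordEval_mul, MixedId.wordEval_inl, MixedId.spell, MixedId.wordEval, map_one,
      one_mul] at hc
    exact hW (by rw [hc, map_one, MixedId.spell, one_mul])
  · obtain ⟨_, _, x, i, _⟩ := MixedId.exists_relMap_nonconstant hne
    obtain ⟨g, -, hg⟩ := MixedId.exists_wordEval_spell_notMem hhom hfree hne ℓ hℓ
      (Set.finite_singleton (x i)) (fun _ => 1) (fun _ => ∅) (fun _ => Set.finite_empty)
      (c • x i) (fun _ _ => Set.notMem_empty _) (fun h => absurd h hne')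
    apply hg
    have := heval g
    rw [MixedId.wordEval_mul, MixedId.wordEval_inl] at this
    rw [Set.mem_singleton_iff, ← mul_smul, this, one_smul]
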